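/- Let $p\in[0,1]$ and let $n,m$ be positive integers. Let $\mathcal B_{n,m,p}$ be the random multi-hypergraph on the vertex set $[n]=\{1,\dots,n\}$ whose edges are $m$ independent random subsets of $[n]$ (not necessarily distinct), each of which contains every vertex $v\in[n]$ independently with probability $p$. For a multi-hypergraph $\mathcal H$ let $\min(\mathcal H)$ be the set of its inclusion-wise minimal edges, every minimal edge being counted once regardless of its multiplicity. For $0<p<1$ put $\alpha=-(\log_{1-p}m)/n$, so that $m=1/(1-p)^{\alpha n}$, and let $\mathrm H(x)=-x\log_2x-(1-x)\log_2(1-x)$. If $p=0$ or $p=1$, then $|\min(\mathcal B_{n,m,p})|=1$ with probability one. If $0<p<1$, the following hold. (i) There are constants $c,C>0$, depending only on $p$, such that for all positive integers $n,m$ with $m\le 1/(1-p)^{(1-p)n}$ $$c\,m\le \mathbb E\bigl[|\min(\mathcal B_{n,m,p})|\bigr]\le C\,m .$$ (ii) For all $\varepsilon,\varepsilon'>0$ there are constants $c,C>0$, depending only on $p,\varepsilon,\varepsilon'$, such that for all positive integers $n,m$ with $1/(1-p)^{(1-p+\varepsilon)n}\le m\le 1/(1-p)^{(1-\varepsilon')n}$,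 equivalently $1-p+\varepsilon\le\alpha\le1-\varepsilon'$, $$c\,\frac{2^{(\mathrm H(\alpha)+(1-\alpha)\log_2p)\,n}}{\sqrt n}\le \mathbb E\bigl[|\min(\mathcal B_{n,m,p})|\bigr]\le C\,\frac{2^{(\mathrm H(\alpha)+(1-\alpha)\log_2p)\,n}}{\sqrt n},$$ and the same two bounds hold with $\Bigl(\dfrac{p^{1-\alpha}}{(1-\alpha)^{1-\alpha}\,\alpha^{\alpha}}\Bigr)^{n}\Big/\sqrt n$ in place of $2^{(\mathrm H(\alpha)+(1-\alpha)\log_2p)\,n}/\sqrt n$. (iii) Let $m=m(n)$ be a sequence of positive integers with $m(n)=1/(1-p)^{n+f(n)}$ for all $n\ge1$, where $f(n)/\log n\to+\infty$ as $n\to\infty$. Then $1\le\mathbb E\bigl[|\min(\mathcal B_{n,m(n),p})|\bigr]$ for all $n\ge1$, and $\mathbb E\bigl[|\min(\mathcal B_{n,m(n),p})|\bigr]\to1$ as $n\to\infty$. -/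

import Mathlib

open MeasureTheory ProbabilityTheory Filter Topology

/-- A multi-hypergraph on the vertex set `V`: a multiset of subsets of `V`. -/
abbrev MultiHypergraph (V : Type*) := Multiset (Set V)

/-- The minimization of a multi-hypergraph: the (plain) set of its inclusion-wise minimal edges,
each minimal edge being listed once, whatever its multiplicity. -/
def MultiHypergraph.minimization {V : Type*} (H : MultiHypergraph V) : Set (Set V) :=
  {E | E ∈ H ∧ ∀ E' ∈ H, E' ⊆ E → E' = E}

/-- The multi-hypergraph formed by the outcomes of `m` trials, each a subset of an `n`-set. -/
def ofTrials {n m : ℕ} (X : Fin m → Set (Fin n)) : MultiHypergraph (Fin n) :=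
  Finset.univ.val.map X

/-- The law of `m` independent random subsets of an `n`-set, each of which contains every vertex
independently with probability `p`. -/
noncomputable def trialLaw (n m : ℕ) (p : unitInterval) : Measure (Fin m → Set (Fin n)) :=
  Measure.pi fun _ => setBernoulli (Set.univ : Set (Fin n)) p

/-- The expected number of minimal edges of the random multi-hypergraph with `n` vertices, `m`
edges and sampling probability `p`. -/
noncomputable def expectedMin (n m : ℕ) (p : unitInterval) : ℝ :=
  ∫ X, ((ofTrials X).minimization.ncard : ℝ) ∂(trialLaw n m p)

/-- `α = -(log_{1-p} m) / n`, so that `m = (1 / (1 - p)) ^ (α n)`. -/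
noncomputable def logDensity (n m : ℕ) (p : unitInterval) : ℝ :=
  -(Real.logb (1 - (p : ℝ)) (m : ℝ)) / (n : ℝ)

/-- The binary entropy function, in bits. -/
noncomputable def entropyBits (x : ℝ) : ℝ :=
  -x * Real.logb 2 x - (1 - x) * Real.logb 2 (1 - x)

instance (n m : ℕ) (p : unitInterval) : IsProbabilityMeasure (trialLaw n m p) := by
  unfold trialLaw; infer_instance

/-- The number of minimal edges is integrable, so `expectedMin` is a genuine expectation. -/
theorem integrable_minimization (n m : ℕ) (p : unitInterval) :
    Integrable (fun X : Fin m → Set (Fin n) => ((ofTrials X).minimization.ncard : ℝ))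
      (trialLaw n m p) :=
  Integrable.of_finite

/-!
Write `q = 1 - p`. A set missing `j` of the `n` vertices contains a random edge with probability
`q ^ j`, and properly so with probability `q ^ j (1 - p ^ (n - j))`. By independence of the edges
it is a minimal edge with probability `(1 - q ^ j (1 - p ^ (n - j))) ^ m - (1 - q ^ j) ^ m`, and
summing over all sets gives the exact formula `expectedMin_eq_sum`. The difference of `m`-th powers
lies between `m q ^ j p ^ (n - j)`, the expected multiplicity of the set as an edge, times
`(1 - q ^ j) ^ (m - 1)` and the same times `(1 - q ^ j (1 - p ^ (n - j))) ^ (m - 1)`.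

If `m q ^ j ≤ 1`, the lower factor is at least `1 / e`; so `expectedMin` is at least `m / e` times
the probability that a binomial variable with parameters `n`, `q` falls among such `j`
(`mul_sum_le_expectedMin`). In the linear regime these include all `j ≥ q n`, and a binomial variable
reaches its mean with probability bounded below, by a comparison of its second and fourth moments
(`le_sum_choose_filter_mean_le`). The upper bound `m` is trivial.

In the information-theoretic regime the sum is dominated by `J = ⌈α n⌉`, where `m q ^ J` is of
order `1`. For `j > J ≥ (q + ε) n` the binomial weights decay geometrically. For `j = J - t` the
number of sets grows at most geometrically in `t`, whereas `m q ^ j` is of order `(1 / q) ^ t`, so the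
probability of having no edge as a proper subset is doubly exponentially small
(`expectedMin_le_of_geometric`). The term at `J` is of the order of
`(n.choose J) p ^ (n - J)`, which Stirling's formula evaluates (`choose_mul_pow_bounds`).

Beyond that regime, the empty set is an edge about `q ^ (-f n)` times, more than any power of `n`,
and the nonempty sets contribute at most `(1 + x) ^ n - 1` with `n x → 0` (`expectedMin_le_exp`).
-/

/-! ### The law of the minimal edges -/

theorem setBernoulli_real_subsets {n : ℕ} (p : unitInterval) (F : Finset (Fin n)) :
    (setBernoulli (Set.univ : Set (Fin n)) p).real {S | S ⊆ (F : Set (Fin n))}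
      = (1 - (p : ℝ)) ^ (n - F.card) := by
  classical
  have hset : {S : Set (Fin n) | S ⊆ (F : Set (Fin n))}
      = ⋃ G ∈ F.powerset, {((G : Finset (Fin n)) : Set (Fin n))} := by
    ext S
    simp only [Set.mem_ofPred_eq, Finset.mem_powerset, Set.mem_iUnion, Set.mem_singleton_iff,
      exists_prop]
    constructor
    · intro h
      refine ⟨S.toFinite.toFinset, ?_, by simp⟩
      rw [← Finset.coe_subset]; simpa using h
    · rintro ⟨G, hG, rfl⟩
      exact_mod_cast hG
  rw [hset, measureReal_biUnion_finset]
  · have : ∀ G ∈ F.powerset, (setBernoulli (Set.univ : Set (Fin n)) p).real {(G : Set (Fin n))}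
        = (p : ℝ) ^ G.card * (1 - (p : ℝ)) ^ (F.card - G.card) * (1 - (p : ℝ)) ^ (n - F.card) := by
      intro G hG
      rw [setBernoulli_real_singleton p (Set.subset_univ _) Set.finite_univ,
        Set.ncard_coe_finset, ← Set.compl_eq_univ_sdiff, ← Finset.coe_compl, Set.ncard_coe_finset,
        Finset.card_compl, Fintype.card_fin, mul_assoc, ← pow_add]
      congr 2
      have h1 := Finset.card_le_card (Finset.mem_powerset.1 hG)
      have h2 := Finset.card_le_univ F
      simp only [Fintype.card_fin] at h2
      omega
    rw [Finset.sum_congr rfl this, ← Finset.sum_mul, Finset.sum_pow_mul_eq_add_pow]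
    simp
  · intro G _ G' _ h
    simpa [Function.onFun] using h
  · intro _ _; exact MeasurableSet.of_discrete

theorem mem_minimization_ofTrials {n m : ℕ} (X : Fin m → Set (Fin n)) (E : Set (Fin n)) :
    E ∈ (ofTrials X).minimization ↔ (∃ i, X i = E) ∧ ∀ i, ¬ X i ⊂ E := by
  simp only [MultiHypergraph.minimization, ofTrials, Set.mem_ofPred_eq, Multiset.mem_map,
    Finset.mem_val, Finset.mem_univ, true_and, forall_exists_index, forall_apply_eq_imp_iff,
    ssubset_iff_subset_ne, not_and, not_not, ne_eq]

theorem trialLaw_real_forall_mem (n m : ℕ) (p : unitInterval) (A : Set (Set (Fin n))) :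
    (trialLaw n m p).real {X | ∀ i, X i ∈ A}
      = ((setBernoulli (Set.univ : Set (Fin n)) p).real A) ^ m := by
  have : {X : Fin m → Set (Fin n) | ∀ i, X i ∈ A} = Set.univ.pi fun _ => A := by
    ext; simp
  rw [this, trialLaw, measureReal_def, Measure.pi_pi]
  simp [measureReal_def]

/-- A set is a minimal edge iff no edge is a proper subset of it while some edge is a subset of it;
both conditions constrain the independent trials separately. -/
theorem trialLaw_real_mem_minimization (n m : ℕ) (p : unitInterval) (F : Finset (Fin n)) :
    (trialLaw n m p).real {X | (F : Set (Fin n)) ∈ (ofTrials X).minimization}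
      = (1 - (1 - (p : ℝ)) ^ (n - F.card) * (1 - (p : ℝ) ^ F.card)) ^ m
        - (1 - (1 - (p : ℝ)) ^ (n - F.card)) ^ m := by
  classical
  set μ := setBernoulli (Set.univ : Set (Fin n)) p
  have hset : {X : Fin m → Set (Fin n) | (F : Set (Fin n)) ∈ (ofTrials X).minimization}
      = {X | ∀ i, X i ∈ {S | ¬ S ⊂ (F : Set (Fin n))}} \
        {X | ∀ i, X i ∈ {S | ¬ S ⊆ (F : Set (Fin n))}} := by
    ext X
    simp only [Set.mem_ofPred_eq, mem_minimization_ofTrials, Set.mem_sdiff, not_forall, not_not]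
    constructor
    · rintro ⟨⟨i, hi⟩, h⟩
      exact ⟨h, i, hi.le⟩
    · rintro ⟨h, i, hi⟩
      refine ⟨⟨i, ?_⟩, h⟩
      by_contra hne
      exact h i (hi.ssubset_of_ne hne)
  have hB : μ.real {S | ¬ S ⊆ (F : Set (Fin n))} = 1 - (1 - (p : ℝ)) ^ (n - F.card) := by
    rw [← setBernoulli_real_subsets p F, ← probReal_compl_eq_one_sub MeasurableSet.of_discrete]
    rfl
  have hF : μ.real {(F : Set (Fin n))} = (p : ℝ) ^ F.card * (1 - (p : ℝ)) ^ (n - F.card) := by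
    rw [setBernoulli_real_singleton p (Set.subset_univ _) Set.finite_univ,
      Set.ncard_coe_finset, ← Set.compl_eq_univ_sdiff, ← Finset.coe_compl, Set.ncard_coe_finset,
      Finset.card_compl, Fintype.card_fin]
  have hA : μ.real {S | ¬ S ⊂ (F : Set (Fin n))}
      = 1 - (1 - (p : ℝ)) ^ (n - F.card) * (1 - (p : ℝ) ^ F.card) := by
    have : {S : Set (Fin n) | ¬ S ⊂ (F : Set (Fin n))}
        = {S | ¬ S ⊆ (F : Set (Fin n))} ∪ {(F : Set (Fin n))} := by
      ext S
      simp only [Set.mem_ofPred_eq, Set.mem_union, Set.mem_singleton_iff, ssubset_iff_subset_ne]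
      tauto
    rw [this, measureReal_union (by simp) MeasurableSet.of_discrete, hB, hF]
    ring
  rw [hset, measureReal_sdiff _ MeasurableSet.of_discrete, trialLaw_real_forall_mem,
    trialLaw_real_forall_mem, hA, hB]
  intro X hX i hi
  exact hX i hi.subset

/-- The expected number of minimal edges, summed over the number `j` of vertices missing from the
edge. -/
theorem expectedMin_eq_sum (n m : ℕ) (p : unitInterval) :
    expectedMin n m p = ∑ j ∈ Finset.range (n + 1), (n.choose j : ℝ) *
      ((1 - (1 - (p : ℝ)) ^ j * (1 - (p : ℝ) ^ (n - j))) ^ m - (1 - (1 - (p : ℝ)) ^ j) ^ m) := by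
  classical
  have hcard : ∀ X : Fin m → Set (Fin n), ((ofTrials X).minimization.ncard : ℝ)
      = ∑ F : Finset (Fin n),
        {X | (F : Set (Fin n)) ∈ (ofTrials X).minimization}.indicator (fun _ => (1 : ℝ)) X := by
    intro X
    have : (ofTrials X).minimization = (fun F : Finset (Fin n) => (F : Set (Fin n))) ''
        (Finset.univ.filter fun F : Finset (Fin n) =>
          (F : Set (Fin n)) ∈ (ofTrials X).minimization : Finset (Finset (Fin n))) := by
      ext S
      simp only [Finset.coe_filter, Finset.mem_univ, true_and, Set.mem_image, Set.mem_ofPred_eq]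
      constructor
      · intro h
        exact ⟨S.toFinite.toFinset, by simpa using h, by simp⟩
      · rintro ⟨F, h, rfl⟩
        exact h
    rw [this, Set.ncard_image_of_injective _ Finset.coe_injective, Set.ncard_coe_finset,
      Finset.card_filter]
    push_cast
    refine Finset.sum_congr rfl fun F _ => ?_
    simp [Set.indicator_apply]
  have hsum : expectedMin n m p
      = ∑ F : Finset (Fin n), ((1 - (1 - (p : ℝ)) ^ (n - F.card) * (1 - (p : ℝ) ^ F.card)) ^ m
        - (1 - (1 - (p : ℝ)) ^ (n - F.card)) ^ m) := by
    unfold expectedMin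
    simp_rw [hcard]
    rw [integral_finsetSum _ fun _ _ => Integrable.of_finite]
    refine Finset.sum_congr rfl fun F _ => ?_
    rw [integral_indicator_const _ MeasurableSet.of_discrete, trialLaw_real_mem_minimization]
    simp
  rw [hsum, ← Finset.powerset_univ, Finset.sum_powerset_apply_card (fun k =>
    (1 - (1 - (p : ℝ)) ^ (n - k) * (1 - (p : ℝ) ^ k)) ^ m - (1 - (1 - (p : ℝ)) ^ (n - k)) ^ m),
    Finset.card_univ, Fintype.card_fin, ← Finset.sum_range_reflect]
  refine Finset.sum_congr rfl fun j hj => ?_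
  have hj : j ≤ n := Nat.lt_succ_iff.1 (Finset.mem_range.1 hj)
  rw [show n + 1 - 1 - j = n - j by omega, Nat.choose_symm hj, Nat.sub_sub_self hj, nsmul_eq_mul]

theorem ncard_minimization_le {n m : ℕ} (X : Fin m → Set (Fin n)) :
    (ofTrials X).minimization.ncard ≤ m := by
  have hsub : (ofTrials X).minimization ⊆ Set.range X := fun E hE =>
    ((mem_minimization_ofTrials X E).1 hE).1
  calc (ofTrials X).minimization.ncard ≤ (Set.range X).ncard := Set.ncard_le_ncard hsub
    _ ≤ m := by
        rw [← Set.image_univ]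
        exact (Set.ncard_image_le Set.finite_univ).trans (by simp [Set.ncard_univ])

theorem one_le_ncard_minimization {n m : ℕ} (hm : 1 ≤ m) (X : Fin m → Set (Fin n)) :
    1 ≤ (ofTrials X).minimization.ncard := by
  have : Nonempty (Fin m) := ⟨⟨0, hm⟩⟩
  obtain ⟨i, -, hi⟩ := (Set.finite_univ (α := Fin m)).exists_minimalFor X _ Set.univ_nonempty
  rw [Nat.one_le_iff_ne_zero, ← Nat.pos_iff_ne_zero, Set.ncard_pos]
  exact ⟨X i, (mem_minimization_ofTrials X _).2 ⟨⟨i, rfl⟩, fun k hk =>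
    hk.2 (hi (Set.mem_univ k) hk.1)⟩⟩

theorem expectedMin_le (n m : ℕ) (p : unitInterval) : expectedMin n m p ≤ m := by
  have h := integral_mono (integrable_minimization n m p) (integrable_const (m : ℝ))
    fun X => Nat.cast_le.2 (ncard_minimization_le X)
  simpa [expectedMin] using h

theorem one_le_expectedMin (n : ℕ) {m : ℕ} (hm : 1 ≤ m) (p : unitInterval) :
    1 ≤ expectedMin n m p := by
  have h := integral_mono (integrable_const (1 : ℝ)) (integrable_minimization n m p)
    fun X => Nat.one_le_cast.2 (one_le_ncard_minimization hm X)
  simpa [expectedMin] using h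

/-- If every trial has the same outcome, there is exactly one minimal edge. -/
theorem ae_ncard_minimization_eq_one_of_dirac {n m : ℕ} (hm : 1 ≤ m) {p : unitInterval}
    {S : Set (Fin n)} (h : setBernoulli (Set.univ : Set (Fin n)) p = Measure.dirac S) :
    ∀ᵐ X ∂(trialLaw n m p), (ofTrials X).minimization.ncard = 1 := by
  have hall : ∀ᵐ X ∂(trialLaw n m p), ∀ i, X i = S := by
    refine ae_all_iff.2 fun i => ?_
    have hS : ∀ᵐ T ∂(setBernoulli (Set.univ : Set (Fin n)) p), T = S := by
      rw [h, ae_dirac_eq]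
      exact rfl
    exact (Measure.tendsto_eval_ae_ae (i := i)
      (μ := fun _ : Fin m => setBernoulli (Set.univ : Set (Fin n)) p)).eventually hS
  filter_upwards [hall] with X hX
  refine le_antisymm ?_ (one_le_ncard_minimization hm X)
  refine (Set.ncard_le_ncard (t := {S}) fun E hE => ?_).trans (Set.ncard_singleton S).le
  obtain ⟨⟨i, rfl⟩, -⟩ := (mem_minimization_ofTrials X E).1 hE
  exact hX i

/-! ### Moments of the binomial distribution -/

/-- Adding one trial to a binomial variable: conditioning on the new trial. -/
theorem sum_range_succ_choose_mul (x y : ℝ) (n : ℕ) (g : ℕ → ℝ) :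
    ∑ j ∈ Finset.range (n + 1 + 1), ((n + 1).choose j : ℝ) * x ^ j * y ^ (n + 1 - j) * g j
      = ∑ j ∈ Finset.range (n + 1), (n.choose j : ℝ) * x ^ j * y ^ (n - j) *
          (x * g (j + 1) + y * g j) := by
  have h1 : ∑ j ∈ Finset.range (n + 1), (n.choose j : ℝ) * x ^ j * y ^ (n - j) * (y * g j)
      = ∑ j ∈ Finset.range (n + 1), (n.choose (j + 1) : ℝ) * x ^ (j + 1) * y ^ (n - j) * g (j + 1)
        + y ^ (n + 1) * g 0 := by
    rw [Finset.sum_range_succ', Finset.sum_range_succ _ n]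
    have : ∀ j ∈ Finset.range n,
        (n.choose (j + 1) : ℝ) * x ^ (j + 1) * y ^ (n - (j + 1)) * (y * g (j + 1))
        = (n.choose (j + 1) : ℝ) * x ^ (j + 1) * y ^ (n - j) * g (j + 1) := by
      intro j hj
      rw [show n - j = n - (j + 1) + 1 by have := Finset.mem_range.1 hj; omega]
      ring
    rw [Finset.sum_congr rfl this]
    simp
    ring
  simp only [mul_add, Finset.sum_add_distrib]
  rw [h1, Finset.sum_range_succ', ← add_assoc, ← Finset.sum_add_distrib]
  congr 1
  · refine Finset.sum_congr rfl fun j hj => ?_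
    rw [Nat.choose_succ_succ, Nat.add_sub_add_right]
    push_cast
    ring
  · simp

theorem sum_choose_mul_pow_mul_pow {x y : ℝ} (h : x + y = 1) (n : ℕ) :
    ∑ j ∈ Finset.range (n + 1), (n.choose j : ℝ) * x ^ j * y ^ (n - j) = 1 := by
  have := add_pow x y n
  rw [h, one_pow] at this
  rw [this]
  exact Finset.sum_congr rfl fun j _ => by ring

theorem sum_choose_mul_centered {x y : ℝ} (h : x + y = 1) (n : ℕ) :
    ∑ j ∈ Finset.range (n + 1), (n.choose j : ℝ) * x ^ j * y ^ (n - j) * (j - n * x) = 0 := by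
  induction n with
  | zero => simp
  | succ n ih =>
    rw [sum_range_succ_choose_mul, ← ih]
    refine Finset.sum_congr rfl fun j _ => ?_
    obtain rfl : y = 1 - x := by linarith
    push_cast
    ring

theorem sum_choose_mul_centered_sq {x y : ℝ} (h : x + y = 1) (n : ℕ) :
    ∑ j ∈ Finset.range (n + 1), (n.choose j : ℝ) * x ^ j * y ^ (n - j) * (j - n * x) ^ 2
      = n * (x * y) := by
  induction n with
  | zero => simp
  | succ n ih =>
    rw [sum_range_succ_choose_mul]
    have : ((n + 1 : ℕ) : ℝ) * (x * y) = n * (x * y) + x * y * 1 := by push_cast; ring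
    rw [this, ← ih, ← sum_choose_mul_pow_mul_pow h n, Finset.mul_sum, ← Finset.sum_add_distrib]
    refine Finset.sum_congr rfl fun j _ => ?_
    obtain rfl : y = 1 - x := by linarith
    push_cast
    ring

theorem sum_choose_mul_centered_pow_four {x y : ℝ} (h : x + y = 1) (n : ℕ) :
    ∑ j ∈ Finset.range (n + 1), (n.choose j : ℝ) * x ^ j * y ^ (n - j) * (j - n * x) ^ 4
      = n * (x * y) * (1 + 3 * (n - 2) * (x * y)) := by
  induction n with
  | zero => simp
  | succ n ih =>
    rw [sum_range_succ_choose_mul]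
    have : ((n + 1 : ℕ) : ℝ) * (x * y) * (1 + 3 * ((n + 1 : ℕ) - 2) * (x * y))
        = n * (x * y) * (1 + 3 * (n - 2) * (x * y)) + 6 * (x * y) * (n * (x * y))
          + 4 * (x * y ^ 3 - y * x ^ 3) * 0 + (x * y - 3 * (x * y) ^ 2) * 1 := by
      push_cast; ring
    rw [this, ← ih, ← sum_choose_mul_centered_sq h n, ← sum_choose_mul_centered h n,
      ← sum_choose_mul_pow_mul_pow h n, Finset.mul_sum, Finset.mul_sum, Finset.mul_sum,
      ← Finset.sum_add_distrib, ← Finset.sum_add_distrib, ← Finset.sum_add_distrib]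
    refine Finset.sum_congr rfl fun j _ => ?_
    obtain rfl : y = 1 - x := by linarith
    push_cast
    ring

/-- A binomial variable is at least its mean with probability bounded below. The indicator of
`0 ≤ u` dominates `(4 u + u ^ 2 - u ^ 4 / 4) / 8`, whose expectation at the normalized variable
`u = (j - n x) / √n` is controlled by the second and fourth moments. -/
theorem le_sum_choose_filter_mean_le {x y : ℝ} (hx : 0 ≤ x) (hy : 0 ≤ y) (h : x + y = 1) {n : ℕ}
    (hn : 1 ≤ n) :
    x * y / 16 ≤ ∑ j ∈ (Finset.range (n + 1)).filter (fun j : ℕ => (n : ℝ) * x ≤ j),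
      (n.choose j : ℝ) * x ^ j * y ^ (n - j) := by
  have hn' : (1 : ℝ) ≤ n := by exact_mod_cast hn
  have hs : (0 : ℝ) < √n := by positivity
  have hs2 : √(n : ℝ) ^ 2 = n := Real.sq_sqrt (by positivity)
  have key : ∀ u : ℝ, (4 * u + u ^ 2 - u ^ 4 / 4) / 8 ≤ if 0 ≤ u then 1 else 0 := by
    intro u
    split_ifs with hu
    · nlinarith [mul_nonneg (sq_nonneg (u - 2)) (by positivity : 0 ≤ u ^ 2 + 4 * u + 8)]
    · have hu : u < 0 := not_le.1 hu
      rcases le_or_gt (-4) u with h4 | h4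
      · nlinarith [mul_nonneg_of_nonpos_of_nonpos hu.le (by linarith : -(u + 4) ≤ 0),
          sq_nonneg (u ^ 2)]
      · nlinarith [mul_nonneg (sq_nonneg u) (by nlinarith : 0 ≤ u ^ 2 - 4)]
  have hxy : 0 ≤ x * y := by positivity
  have hxy4 : x * y ≤ 1 / 4 := by
    obtain rfl : y = 1 - x := by linarith
    nlinarith [sq_nonneg (x - 1 / 2)]
  calc x * y / 16 ≤ (1 / (2 * √n)) * 0 + (1 / (8 * n)) * (n * (x * y))
        - (1 / (32 * n ^ 2)) * (n * (x * y) * (1 + 3 * (n - 2) * (x * y))) := by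
        have : (1 / (8 * n)) * (n * (x * y)) = x * y / 8 := by field_simp
        rw [this]
        have h2 : (1 / (32 * (n : ℝ) ^ 2)) * (n * (x * y) * (1 + 3 * (n - 2) * (x * y)))
            ≤ x * y / 16 := by
          rw [one_div, inv_mul_le_iff₀ (by positivity)]
          have : 1 + 3 * ((n : ℝ) - 2) * (x * y) ≤ 2 * n := by nlinarith
          calc n * (x * y) * (1 + 3 * ((n : ℝ) - 2) * (x * y)) ≤ n * (x * y) * (2 * n) := by gcongr
            _ = _ := by ring
        linarith
    _ = ∑ j ∈ Finset.range (n + 1), (n.choose j : ℝ) * x ^ j * y ^ (n - j) *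
          ((4 * ((j - n * x) / √n) + ((j - n * x) / √n) ^ 2 - ((j - n * x) / √n) ^ 4 / 4) / 8) := by
        rw [← sum_choose_mul_centered_pow_four h n, ← sum_choose_mul_centered_sq h n,
          ← sum_choose_mul_centered h n, Finset.mul_sum, Finset.mul_sum, Finset.mul_sum,
          ← Finset.sum_add_distrib, ← Finset.sum_sub_distrib]
        refine Finset.sum_congr rfl fun j _ => ?_
        have hs4 : √(n : ℝ) ^ 4 = (n : ℝ) ^ 2 := by
          rw [show √(n : ℝ) ^ 4 = (√(n : ℝ) ^ 2) ^ 2 by ring, hs2]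
        rw [div_pow, div_pow, hs2, hs4]
        field_simp
        ring
    _ ≤ ∑ j ∈ Finset.range (n + 1), (n.choose j : ℝ) * x ^ j * y ^ (n - j) *
          (if 0 ≤ (j - n * x) / √n then 1 else 0) :=
        Finset.sum_le_sum fun j _ => mul_le_mul_of_nonneg_left (key _) (by positivity)
    _ = _ := by
        rw [Finset.sum_filter]
        refine Finset.sum_congr rfl fun j _ => ?_
        have : 0 ≤ ((j : ℝ) - n * x) / √n ↔ (n : ℝ) * x ≤ j := by
          rw [le_div_iff₀ hs, zero_mul, sub_nonneg]
        simp [this]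

/-! ### The lower bound and the linear regime -/

theorem mul_sub_mul_pow_le_pow_sub_pow {a b : ℝ} (hb : 0 ≤ b) (hab : b ≤ a) (m : ℕ) :
    m * (a - b) * b ^ (m - 1) ≤ a ^ m - b ^ m := by
  rw [← (Commute.all a b).mul_geom_sum₂]
  have : (m : ℝ) * b ^ (m - 1) ≤ ∑ i ∈ Finset.range m, a ^ i * b ^ (m - 1 - i) := by
    rw [← nsmul_eq_mul, ← Finset.card_range m, Finset.card_range]
    nth_rw 1 [← Finset.card_range m]
    refine Finset.card_nsmul_le_sum _ _ _ fun i hi => ?_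
    have := Finset.mem_range.1 hi
    calc b ^ (m - 1) = b ^ i * b ^ (m - 1 - i) := by rw [← pow_add]; congr 1; omega
      _ ≤ _ := by gcongr
  calc _ = (a - b) * (m * b ^ (m - 1)) := by ring
    _ ≤ _ := mul_le_mul_of_nonneg_left this (sub_nonneg.2 hab)

theorem pow_sub_pow_le_mul_sub_mul_pow {a b : ℝ} (hb : 0 ≤ b) (hab : b ≤ a) (m : ℕ) :
    a ^ m - b ^ m ≤ m * (a - b) * a ^ (m - 1) := by
  rw [← (Commute.all a b).mul_geom_sum₂]
  have : ∑ i ∈ Finset.range m, a ^ i * b ^ (m - 1 - i) ≤ (m : ℝ) * a ^ (m - 1) := by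
    rw [← nsmul_eq_mul]
    nth_rw 3 [← Finset.card_range m]
    refine Finset.sum_le_card_nsmul _ _ _ fun i hi => ?_
    have := Finset.mem_range.1 hi
    have ha := hb.trans hab
    calc a ^ i * b ^ (m - 1 - i) ≤ a ^ i * a ^ (m - 1 - i) := by gcongr
      _ = a ^ (m - 1) := by rw [← pow_add]; congr 1; omega
  calc (a - b) * _ ≤ (a - b) * (m * a ^ (m - 1)) :=
        mul_le_mul_of_nonneg_left this (sub_nonneg.2 hab)
    _ = _ := by ring

theorem exp_neg_one_le_one_sub_pow {m : ℕ} {x : ℝ} (h : m * x ≤ 1) :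
    Real.exp (-1) ≤ (1 - x) ^ (m - 1) := by
  rcases m with _ | k
  · simp
  rcases Nat.eq_zero_or_pos k with rfl | hk
  · simp
  have hk' : (0 : ℝ) < k := by exact_mod_cast hk
  have hx : (1 + (k : ℝ)⁻¹)⁻¹ ≤ 1 - x := by
    rw [inv_le_iff_one_le_mul₀ (by positivity)]
    push_cast at h
    field_simp
    nlinarith
  calc Real.exp (-1) = (Real.exp 1)⁻¹ := Real.exp_neg 1
    _ ≤ ((1 + (k : ℝ)⁻¹) ^ k)⁻¹ := by
        gcongr
        exact Real.one_add_inv_pow_le_exp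
    _ = ((1 + (k : ℝ)⁻¹)⁻¹) ^ k := (inv_pow _ _).symm
    _ ≤ (1 - x) ^ k := by gcongr

/-- If a set of cardinality `n - j` contains at most one of the `m` edges on average, then it is
minimal with probability comparable to that of being an edge. -/
theorem mul_sum_le_expectedMin {n m : ℕ} {p : unitInterval} {q : ℝ} (hq : q = 1 - (p : ℝ))
    {s : Finset ℕ} (hs : s ⊆ Finset.range (n + 1)) (hm : ∀ j ∈ s, m * q ^ j ≤ 1) :
    Real.exp (-1) * (m * ∑ j ∈ s, (n.choose j : ℝ) * q ^ j * (p : ℝ) ^ (n - j))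
      ≤ expectedMin n m p := by
  have hp0 : 0 ≤ (p : ℝ) := p.2.1
  have hp1 : (p : ℝ) ≤ 1 := p.2.2
  have hq0 : 0 ≤ q := by linarith
  have hq1 : q ≤ 1 := by linarith
  have hb : ∀ j, 0 ≤ 1 - q ^ j := fun j => sub_nonneg.2 (pow_le_one₀ hq0 hq1)
  have hab : ∀ j, 1 - q ^ j ≤ 1 - q ^ j * (1 - (p : ℝ) ^ (n - j)) := fun j => by
    have : 0 ≤ q ^ j * (p : ℝ) ^ (n - j) := by positivity
    linarith
  rw [expectedMin_eq_sum, ← hq, Finset.mul_sum, Finset.mul_sum]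
  refine (Finset.sum_le_sum fun j hj => ?_).trans
    (Finset.sum_le_sum_of_subset_of_nonneg hs fun j _ _ => ?_)
  · have h1 := mul_sub_mul_pow_le_pow_sub_pow (hb j) (hab j) m
    have h2 := exp_neg_one_le_one_sub_pow (hm j hj)
    calc Real.exp (-1) * (m * ((n.choose j : ℝ) * q ^ j * (p : ℝ) ^ (n - j)))
        ≤ (1 - q ^ j) ^ (m - 1) * (m * ((n.choose j : ℝ) * q ^ j * (p : ℝ) ^ (n - j))) := by
          gcongr
      _ = (n.choose j : ℝ) * (m * ((1 - q ^ j * (1 - (p : ℝ) ^ (n - j))) - (1 - q ^ j))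
            * (1 - q ^ j) ^ (m - 1)) := by ring
      _ ≤ _ := by gcongr
  · have := pow_le_pow_left₀ (hb j) (hab j) m
    exact mul_nonneg (by positivity) (sub_nonneg.2 this)

theorem linear_bounds_expectedMin {p : unitInterval} (hp0 : 0 < (p : ℝ)) (hp1 : (p : ℝ) < 1) :
    ∃ c C : ℝ, 0 < c ∧ 0 < C ∧ ∀ n m : ℕ, 1 ≤ n → 1 ≤ m →
      (m : ℝ) ≤ 1 / (1 - (p : ℝ)) ^ ((1 - (p : ℝ)) * n) →
        c * m ≤ expectedMin n m p ∧ expectedMin n m p ≤ C * m := by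
  obtain ⟨q, hq⟩ : ∃ q, q = 1 - (p : ℝ) := ⟨_, rfl⟩
  have hq0 : 0 < q := by linarith
  refine ⟨Real.exp (-1) * (q * p / 16), 1, by positivity, one_pos, fun n m hn _ hm => ⟨?_, ?_⟩⟩
  · refine le_trans ?_ (mul_sum_le_expectedMin hq (Finset.filter_subset
      (fun j : ℕ => (n : ℝ) * q ≤ j) _) fun j hj => ?_)
    · have := le_sum_choose_filter_mean_le hq0.le hp0.le (by linarith : q + p = 1) hn
      calc _ = Real.exp (-1) * (m * (q * p / 16)) := by ring
        _ ≤ _ := by gcongr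
    · have hj := (Finset.mem_filter.1 hj).2
      rw [← hq, le_div_iff₀ (by positivity)] at hm
      refine le_trans ?_ hm
      rw [← Real.rpow_natCast q j]
      gcongr ?_ * ?_
      exact Real.rpow_le_rpow_of_exponent_ge hq0 (by linarith) (by linarith)
  · simpa using expectedMin_le n m p

/-! ### Stirling bounds for binomial coefficients -/

theorem sqrt_mul_pow_le_factorial (j : ℕ) :
    √((j : ℝ) + 1) * ((j : ℝ) / Real.exp 1) ^ j ≤ j.factorial := by
  rcases Nat.eq_zero_or_pos j with rfl | hj
  · simp
  refine le_trans ?_ (Stirling.le_factorial_stirling j)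
  have : (1 : ℝ) ≤ j := by exact_mod_cast hj
  gcongr
  nlinarith [Real.pi_gt_three]

theorem factorial_le_sqrt_mul_pow (j : ℕ) :
    (j.factorial : ℝ) ≤ Real.exp 1 * (√((j : ℝ) + 1) * ((j : ℝ) / Real.exp 1) ^ j) := by
  rcases j with _ | i
  · simp
  have h := Stirling.stirlingSeq'_antitone (Nat.zero_le i)
  simp only [Function.comp_apply, Nat.succ_eq_add_one, zero_add, Stirling.stirlingSeq_one] at h
  rw [Stirling.stirlingSeq, div_le_div_iff₀ (by positivity) (by positivity), mul_comm 2,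
    Real.sqrt_mul (by positivity)] at h
  have h2 : (0 : ℝ) < √2 := by positivity
  calc ((i + 1).factorial : ℝ)
      ≤ Real.exp 1 * (√((i + 1 : ℕ) : ℝ) * (((i + 1 : ℕ) : ℝ) / Real.exp 1) ^ (i + 1)) := by
        nlinarith
    _ ≤ _ := by
        gcongr
        linarith

/-- Stirling's formula for binomial coefficients, with the square roots shifted so that it also
covers `j = 0` and `k = 0`. -/
theorem choose_stirling_bounds (j k : ℕ) :
    Real.exp (-2) * (√((j + k : ℕ) + 1 : ℝ) / (√((j : ℝ) + 1) * √((k : ℝ) + 1)) *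
        (((j + k : ℕ) : ℝ) ^ (j + k) / ((j : ℝ) ^ j * (k : ℝ) ^ k))) ≤ ((j + k).choose j : ℝ) ∧
      ((j + k).choose j : ℝ) ≤
        Real.exp 1 * (√((j + k : ℕ) + 1 : ℝ) / (√((j : ℝ) + 1) * √((k : ℝ) + 1)) *
        (((j + k : ℕ) : ℝ) ^ (j + k) / ((j : ℝ) ^ j * (k : ℝ) ^ k))) := by
  have hpow : ∀ i : ℕ, (0 : ℝ) < (i : ℝ) ^ i := fun i => by
    rcases Nat.eq_zero_or_pos i with rfl | hi
    · simp
    · positivity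
  have hj := hpow j
  have hk := hpow k
  have hn := hpow (j + k)
  have he : (0 : ℝ) < Real.exp 1 := Real.exp_pos 1
  have h := Nat.add_choose_mul_factorial_mul_factorial j k
  have hc : ((j + k).choose j : ℝ) = (j + k).factorial / (j.factorial * k.factorial) := by
    rw [Nat.choose_symm_add, eq_div_iff (by positivity), ← h]
    push_cast
    ring
  have e2 : Real.exp (-2) = (Real.exp 1 * Real.exp 1)⁻¹ := by
    rw [← Real.exp_add, ← Real.exp_neg]; norm_num
  have ljk := mul_le_mul (sqrt_mul_pow_le_factorial j) (sqrt_mul_pow_le_factorial k)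
    (by positivity) (by positivity)
  have ujk := mul_le_mul (factorial_le_sqrt_mul_pow j) (factorial_le_sqrt_mul_pow k)
    (by positivity) (by positivity)
  have hpj : (0 : ℝ) < ((j : ℝ) / Real.exp 1) ^ j := by rw [div_pow]; positivity
  have hpk : (0 : ℝ) < ((k : ℝ) / Real.exp 1) ^ k := by rw [div_pow]; positivity
  rw [hc]
  constructor
  · calc _ = (√((j + k : ℕ) + 1 : ℝ) * (((j + k : ℕ) : ℝ) / Real.exp 1) ^ (j + k)) /
          (Real.exp 1 * (√((j : ℝ) + 1) * ((j : ℝ) / Real.exp 1) ^ j) *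
          (Real.exp 1 * (√((k : ℝ) + 1) * ((k : ℝ) / Real.exp 1) ^ k))) := by
          rw [e2, div_pow, div_pow, div_pow, pow_add (Real.exp 1)]
          field_simp
      _ ≤ _ := by
          gcongr
          exact sqrt_mul_pow_le_factorial (j + k)
  · calc _ ≤ Real.exp 1 * (√((j + k : ℕ) + 1 : ℝ) * (((j + k : ℕ) : ℝ) / Real.exp 1) ^ (j + k)) /
          ((√((j : ℝ) + 1) * ((j : ℝ) / Real.exp 1) ^ j) *
          (√((k : ℝ) + 1) * ((k : ℝ) / Real.exp 1) ^ k)) := by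
          gcongr
          exact factorial_le_sqrt_mul_pow (j + k)
      _ = _ := by
          rw [div_pow, div_pow, div_pow, pow_add (Real.exp 1)]
          field_simp

/-- Replacing `j` by `x ≥ j - 1` in the base of `j ^ j` costs at most a factor `(1 + 1 / x) ^ j`,
which is bounded as long as `j / x` is. -/
theorem pow_self_le_of_le_add_one {j : ℕ} {x N : ℝ} (hx : 0 < x) (h : (j : ℝ) ≤ x + 1)
    (hN : j / x ≤ N) : (j : ℝ) ^ j ≤ Real.exp N * x ^ j := by
  have h1 : (j : ℝ) ≤ Real.exp (1 / x) * x := by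
    have := Real.add_one_le_exp (1 / x)
    calc (j : ℝ) ≤ (1 / x + 1) * x := by field_simp; linarith
      _ ≤ _ := by gcongr
  calc (j : ℝ) ^ j ≤ (Real.exp (1 / x) * x) ^ j := by gcongr
    _ = Real.exp (j / x) * x ^ j := by
        rw [mul_pow, ← Real.exp_nat_mul]; congr 2; ring
    _ ≤ _ := by gcongr

theorem pow_le_exp_one_mul_pow_self {k : ℕ} {x : ℝ} (hx : 0 ≤ x) (h : x ≤ k + 1) :
    x ^ k ≤ Real.exp 1 * (k : ℝ) ^ k := by
  rcases Nat.eq_zero_or_pos k with rfl | hk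
  · simp
  have hk' : (0 : ℝ) < k := by exact_mod_cast hk
  calc x ^ k ≤ ((1 + (k : ℝ)⁻¹) * k) ^ k := by
        gcongr
        field_simp
        linarith
    _ = (1 + (k : ℝ)⁻¹) ^ k * (k : ℝ) ^ k := mul_pow _ _ _
    _ ≤ _ := by
        gcongr
        exact Real.one_add_inv_pow_le_exp

theorem rpow_bounds_of_le_of_le_add_one {x s t : ℝ} (hx0 : 0 < x) (hx1 : x ≤ 1) (hst : s ≤ t)
    (hts : t ≤ s + 1) : x * x ^ s ≤ x ^ t ∧ x ^ t ≤ x ^ s := by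
  refine ⟨?_, Real.rpow_le_rpow_of_exponent_ge hx0 hx1 hst⟩
  have := Real.rpow_le_rpow_of_exponent_ge hx0 hx1 hts
  rwa [Real.rpow_add_one hx0.ne', mul_comm] at this

/-- The size of the binomial coefficient at `j = ⌈α n⌉`, weighted by `p ^ k` with `k = n - j`. The
case `k = 0` is included. -/
theorem choose_mul_pow_bounds {p a b : ℝ} (hp0 : 0 < p) (hp1 : p ≤ 1) (ha : 0 < a) (hb : 0 < b) :
    ∃ c C : ℝ, 0 < c ∧ 0 < C ∧ ∀ (α : ℝ) (j k : ℕ), 1 ≤ j + k → a ≤ α → b ≤ 1 - α →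
      α * (j + k : ℕ) ≤ j → (j : ℝ) ≤ α * (j + k : ℕ) + 1 →
        c * ((p ^ (1 - α) / ((1 - α) ^ (1 - α) * α ^ α)) ^ (j + k) / √((j + k : ℕ) : ℝ))
          ≤ ((j + k).choose j : ℝ) * p ^ k ∧
        ((j + k).choose j : ℝ) * p ^ k ≤
          C * ((p ^ (1 - α) / ((1 - α) ^ (1 - α) * α ^ α)) ^ (j + k) / √((j + k : ℕ) : ℝ)) := by
  refine ⟨Real.exp (-2) * (1 / √2) * (Real.exp (-(1 / a)) * b),
    Real.exp 1 * (√2 / √(a * b)) * (Real.exp 1 / a / p), by positivity, by positivity, ?_⟩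
  intro α j k hn haα hbα hj1 hj2
  obtain ⟨n, hnjk⟩ : ∃ n : ℕ, j + k = n := ⟨_, rfl⟩
  obtain ⟨β, hβ⟩ : ∃ β, β = 1 - α := ⟨_, rfl⟩
  have hα0 : 0 < α := ha.trans_le haα
  have hβ0 : 0 < β := by linarith
  have hα1 : α ≤ 1 := by linarith
  have hβ1 : β ≤ 1 := by linarith
  obtain ⟨hlow, hupp⟩ := choose_stirling_bounds j k
  rw [hnjk] at hn hj1 hj2 hlow hupp ⊢
  rw [← hβ] at hbα ⊢
  have hn1 : (1 : ℝ) ≤ n := by exact_mod_cast hn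
  have hn0 : (0 : ℝ) < n := by linarith
  have hk' : (k : ℝ) = n - j := by rw [← hnjk]; push_cast; ring
  have hjn : (j : ℝ) ≤ n := by rw [← hnjk]; push_cast; linarith [(Nat.cast_nonneg k : (0 : ℝ) ≤ k)]
  have hk1 : (k : ℝ) ≤ β * n := by rw [hk', hβ]; linarith
  have hk2 : β * n ≤ k + 1 := by rw [hk', hβ]; linarith
  have hpow : ∀ i : ℕ, (0 : ℝ) < (i : ℝ) ^ i := fun i => by
    rcases Nat.eq_zero_or_pos i with rfl | hi
    · simp
    · positivity
  have hjj := hpow j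
  have hkk := hpow k
  -- Both `j + 1` and `k + 1` are of order `n`, so the square roots are of order `1 / √n`.
  have hD1 : 1 / √2 * (1 / √(n : ℝ)) ≤ √((n : ℝ) + 1) / (√((j : ℝ) + 1) * √((k : ℝ) + 1)) := by
    have h1 : √((j : ℝ) + 1) ≤ √((n : ℝ) + 1) := Real.sqrt_le_sqrt (by linarith)
    have h2 : √((k : ℝ) + 1) ≤ √2 * √(n : ℝ) := by
      rw [← Real.sqrt_mul (by norm_num)]
      exact Real.sqrt_le_sqrt (by nlinarith)
    calc 1 / √2 * (1 / √(n : ℝ)) = √((n : ℝ) + 1) / (√((n : ℝ) + 1) * (√2 * √(n : ℝ))) := by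
          field_simp
      _ ≤ _ := by gcongr
  have hD2 : √((n : ℝ) + 1) / (√((j : ℝ) + 1) * √((k : ℝ) + 1)) ≤
      √2 / √(a * b) * (1 / √(n : ℝ)) := by
    have h1 : √((n : ℝ) + 1) ≤ √2 * √(n : ℝ) := by
      rw [← Real.sqrt_mul (by norm_num)]
      exact Real.sqrt_le_sqrt (by linarith)
    have h2 : √a * √(n : ℝ) ≤ √((j : ℝ) + 1) := by
      rw [← Real.sqrt_mul ha.le]
      exact Real.sqrt_le_sqrt (by nlinarith)
    have h3 : √b * √(n : ℝ) ≤ √((k : ℝ) + 1) := by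
      rw [← Real.sqrt_mul hb.le]
      exact Real.sqrt_le_sqrt (by nlinarith)
    calc _ ≤ (√2 * √(n : ℝ)) / ((√a * √(n : ℝ)) * (√b * √(n : ℝ))) := by gcongr
      _ = _ := by
          rw [Real.sqrt_mul ha.le]
          field_simp
  -- `j ^ j` and `k ^ k` are of the order of `(α n) ^ j` and `(β n) ^ k`.
  have hN : (n : ℝ) ^ n = (n : ℝ) ^ j * (n : ℝ) ^ k := by rw [← pow_add, hnjk]
  have hP1 : Real.exp (-(1 / a)) * (1 / (α ^ j * β ^ k)) ≤
      (n : ℝ) ^ n / ((j : ℝ) ^ j * (k : ℝ) ^ k) := by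
    have h1 : (j : ℝ) ^ j ≤ Real.exp (1 / a) * (α * n) ^ j := by
      refine pow_self_le_of_le_add_one (by positivity) hj2 ?_
      rw [div_le_div_iff₀ (by positivity) ha]
      nlinarith
    have h2 : (k : ℝ) ^ k ≤ (β * n) ^ k := by gcongr
    calc _ = (n : ℝ) ^ n / ((Real.exp (1 / a) * (α * n) ^ j) * (β * n) ^ k) := by
          rw [hN, mul_pow, mul_pow, Real.exp_neg]
          field_simp
      _ ≤ _ := by gcongr
  have hP2 : (n : ℝ) ^ n / ((j : ℝ) ^ j * (k : ℝ) ^ k) ≤ Real.exp 1 * (1 / (α ^ j * β ^ k)) := by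
    have h1 : (α * n) ^ j ≤ (j : ℝ) ^ j := by gcongr
    have h2 : (β * n) ^ k ≤ Real.exp 1 * (k : ℝ) ^ k :=
      pow_le_exp_one_mul_pow_self (by positivity) hk2
    calc _ = Real.exp 1 * (n : ℝ) ^ n / ((j : ℝ) ^ j * (Real.exp 1 * (k : ℝ) ^ k)) := by
          field_simp
      _ ≤ Real.exp 1 * (n : ℝ) ^ n / ((α * n) ^ j * (β * n) ^ k) := by gcongr
      _ = _ := by
          rw [hN, mul_pow, mul_pow]
          field_simp
  -- The exponents `j` and `k` differ from `α n` and `β n` by at most `1`.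
  obtain ⟨a1, a2⟩ := rpow_bounds_of_le_of_le_add_one hα0 hα1 hj1 hj2
  obtain ⟨b1, b2⟩ := rpow_bounds_of_le_of_le_add_one hβ0 hβ1 hk1 hk2
  obtain ⟨p1, p2⟩ := rpow_bounds_of_le_of_le_add_one hp0 hp1 hk1 hk2
  rw [Real.rpow_natCast] at a1 a2 b1 b2 p1 p2
  have hT : (p ^ β / (β ^ β * α ^ α)) ^ n = p ^ (β * n) / (β ^ (β * n) * α ^ (α * n)) := by
    rw [div_pow, mul_pow, ← Real.rpow_mul_natCast hp0.le, ← Real.rpow_mul_natCast hβ0.le,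
      ← Real.rpow_mul_natCast hα0.le]
  rw [hT]
  have pa := Real.rpow_pos_of_pos hα0 (α * n)
  have pb := Real.rpow_pos_of_pos hβ0 (β * n)
  have pp := Real.rpow_pos_of_pos hp0 (β * n)
  constructor
  · calc _ = Real.exp (-2) * ((1 / √2 * (1 / √(n : ℝ))) *
            (Real.exp (-(1 / a)) * (b * (1 / (α ^ (α * n) * β ^ (β * n)))))) * p ^ (β * n) := by
          field_simp
      _ ≤ Real.exp (-2) * ((1 / √2 * (1 / √(n : ℝ))) *
            (Real.exp (-(1 / a)) * (1 / (α ^ j * β ^ k)))) * p ^ k := by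
          gcongr
          rw [mul_one_div, div_le_div_iff₀ (by positivity) (by positivity), one_mul]
          calc b * (α ^ j * β ^ k) = α ^ j * (b * β ^ k) := by ring
            _ ≤ α ^ (α * n) * (β * β ^ k) := by gcongr
            _ ≤ _ := by gcongr
      _ ≤ Real.exp (-2) * (√((n : ℝ) + 1) / (√((j : ℝ) + 1) * √((k : ℝ) + 1)) *
            ((n : ℝ) ^ n / ((j : ℝ) ^ j * (k : ℝ) ^ k))) * p ^ k := by gcongr
      _ ≤ _ := by gcongr
  · calc _ ≤ Real.exp 1 * (√((n : ℝ) + 1) / (√((j : ℝ) + 1) * √((k : ℝ) + 1)) *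
            ((n : ℝ) ^ n / ((j : ℝ) ^ j * (k : ℝ) ^ k))) * p ^ k := by gcongr
      _ ≤ Real.exp 1 * ((√2 / √(a * b) * (1 / √(n : ℝ))) *
            (Real.exp 1 * (1 / (α ^ j * β ^ k)))) * p ^ k := by gcongr
      _ ≤ Real.exp 1 * ((√2 / √(a * b) * (1 / √(n : ℝ))) *
            (Real.exp 1 * (1 / ((a * α ^ (α * n)) * β ^ (β * n))))) * (p ^ (β * n) / p) := by
          gcongr
          · exact (mul_le_mul_of_nonneg_right haα pa.le).trans a1
          · rwa [le_div_iff₀ hp0, mul_comm]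
      _ = _ := by field_simp

/-! ### The upper bound in the information-theoretic regime -/

/-- Once the ratio `q (n - j) / (p (j + 1))` of consecutive binomial weights is at most `r` at
`j = J`, the weights decay at rate `r` from there on, since that ratio decreases with `j`. Indices
`J + i > n` are harmless, the binomial coefficient being `0` there. -/
theorem binomial_weight_add_le {p q r : ℝ} (hp0 : 0 < p) (hq0 : 0 < q) (hr : 0 ≤ r) {n J : ℕ}
    (h : q * (n - J) ≤ r * p * (J + 1)) (i : ℕ) :
    (n.choose (J + i) : ℝ) * q ^ (J + i) * p ^ (n - (J + i)) ≤
      r ^ i * ((n.choose J : ℝ) * q ^ J * p ^ (n - J)) := by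
  induction i with
  | zero => simp
  | succ i ih =>
    refine le_trans ?_ ((mul_le_mul_of_nonneg_left ih hr).trans_eq (by ring))
    rw [← add_assoc]
    rcases le_or_gt n (J + i) with hn | hn
    · rw [Nat.choose_eq_zero_of_lt (by omega : n < J + i + 1)]
      simp only [Nat.cast_zero, zero_mul]
      positivity
    have hc : (n.choose (J + i + 1) : ℝ) * (J + i + 1) = n.choose (J + i) * (n - (J + i)) := by
      have := Nat.choose_succ_right_eq n (J + i)
      rw [← Nat.cast_add, ← Nat.cast_sub hn.le]
      exact_mod_cast this
    have h1 : q * ((n : ℝ) - (J + i)) ≤ r * p * (J + i + 1) := by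
      have : 0 ≤ q * i := by positivity
      have : 0 ≤ r * p * i := by positivity
      linarith
    have hpos : (0 : ℝ) < p * (J + i + 1) := by positivity
    refine le_of_mul_le_mul_right ?_ hpos
    rw [show n - (J + i) = n - (J + i + 1) + 1 by omega]
    calc (n.choose (J + i + 1) : ℝ) * q ^ (J + i + 1) * p ^ (n - (J + i + 1)) * (p * (J + i + 1))
        = (n.choose (J + i + 1) * (J + i + 1)) * q ^ (J + i) * p ^ (n - (J + i + 1) + 1) * q := by
          ring
      _ = (n.choose (J + i) : ℝ) * q ^ (J + i) * p ^ (n - (J + i + 1) + 1) *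
            (q * (n - (J + i))) := by rw [hc]; ring
      _ ≤ (n.choose (J + i) : ℝ) * q ^ (J + i) * p ^ (n - (J + i + 1) + 1) *
            (r * p * (J + i + 1)) := by gcongr
      _ = _ := by ring

/-- Going down from `J ≤ (1 - b) n + 1`, the binomial coefficients grow at most at rate `1 / b`. -/
theorem choose_sub_le {b : ℝ} (hb : 0 < b) {n J t : ℕ} (hn : 1 ≤ n) (hJn : J ≤ n)
    (h : b * n ≤ n - J + 1) (ht : t ≤ J) :
    (n.choose (J - t) : ℝ) ≤ (1 / b) ^ t * n.choose J := by
  have hn0 : (0 : ℝ) < n := by exact_mod_cast hn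
  induction t with
  | zero => simp
  | succ t ih =>
    have ih := ih (by omega)
    obtain ⟨i, hi⟩ : ∃ i, J - (t + 1) = i := ⟨_, rfl⟩
    have hi' : J - t = i + 1 := by omega
    rw [hi'] at ih
    rw [hi]
    have hc : (n.choose (i + 1) : ℝ) * (i + 1) = n.choose i * (n - i) := by
      have := Nat.choose_succ_right_eq n i
      rw [← Nat.cast_sub (by omega : i ≤ n)]
      exact_mod_cast this
    have hiJ : (i : ℝ) + 1 ≤ J := by exact_mod_cast (by omega : i + 1 ≤ J)
    have hJn' : (J : ℝ) ≤ n := by exact_mod_cast hJn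
    have h1 : (n.choose i : ℝ) * (b * n) ≤ n.choose (i + 1) * n := by
      calc (n.choose i : ℝ) * (b * n) ≤ n.choose i * (n - i) := by
            gcongr; linarith
        _ = n.choose (i + 1) * (i + 1) := hc.symm
        _ ≤ _ := by gcongr; linarith
    have h2 : (n.choose i : ℝ) * b ≤ n.choose (i + 1) :=
      le_of_mul_le_mul_right (by linarith) hn0
    calc (n.choose i : ℝ) ≤ (1 / b) * n.choose (i + 1) := by
          rw [one_div, ← div_eq_inv_mul, le_div_iff₀ hb]; exact h2
      _ ≤ (1 / b) * ((1 / b) ^ t * n.choose J) := by gcongr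
      _ = _ := by ring

/-- A doubly exponentially small sequence beats every geometric one: `exp u ≥ u ^ k / k!` with
`a ^ k > R` gives a geometric majorant. -/
theorem summable_pow_mul_exp_neg_mul_pow {R c a : ℝ} (hR : 0 ≤ R) (hc : 0 < c) (ha : 1 < a) :
    Summable fun t : ℕ => R ^ t * Real.exp (-(c * a ^ t)) := by
  have ha0 : 0 < a := by linarith
  obtain ⟨k, hk⟩ := pow_unbounded_of_one_lt R ha
  refine Summable.of_nonneg_of_le (fun t => by positivity) (fun t => ?_)
    ((summable_geometric_of_lt_one (r := R / a ^ k) (by positivity)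
      ((div_lt_one (by positivity)).2 hk)).mul_left (k.factorial / c ^ k))
  have h := Real.pow_div_factorial_le_exp (c * a ^ t) (by positivity) k
  rw [Real.exp_neg]
  calc R ^ t * (Real.exp (c * a ^ t))⁻¹ ≤ R ^ t * ((c * a ^ t) ^ k / k.factorial)⁻¹ := by gcongr
    _ = _ := by
        rw [mul_pow, div_pow, ← pow_mul, ← pow_mul, mul_comm t k]
        field_simp

/-- With `x = p ^ (n - j)`, the left side is the probability that none of `m` edges is a proper
subset of a given set of size `n - j`. -/
theorem one_sub_pow_le_exp {q x : ℝ} (hq0 : 0 ≤ q) (hq1 : q ≤ 1) {j m : ℕ}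
    (hx0 : 0 ≤ x) (hxq : x ≤ 1 - q) :
    (1 - q ^ j * (1 - x)) ^ m ≤ Real.exp (-(m * q ^ (j + 1))) := by
  have h1 : 1 - q ^ j * (1 - x) ≤ Real.exp (-(q ^ (j + 1))) := by
    have := Real.add_one_le_exp (-(q ^ (j + 1)))
    have h2 : q ^ j * q ≤ q ^ j * (1 - x) := by gcongr; linarith
    rw [pow_succ] at *
    linarith
  have h0 : 0 ≤ 1 - q ^ j * (1 - x) := by
    have : q ^ j * (1 - x) ≤ 1 * 1 :=
      mul_le_mul (pow_le_one₀ hq0 hq1) (by linarith) (by linarith) zero_le_one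
    linarith
  calc _ ≤ Real.exp (-(q ^ (j + 1))) ^ m := by gcongr
    _ = _ := by rw [← Real.exp_nat_mul]; congr 1; ring

/-- The expected number of minimal edges is at most a constant times the contribution of sets
missing `J` vertices, where `J` is the least number of missing vertices for which such a set
contains at most one edge on average. -/
theorem expectedMin_le_of_geometric {n m J : ℕ} {p : unitInterval} {q r b S : ℝ}
    (hq : q = 1 - (p : ℝ)) (hp0 : 0 < (p : ℝ)) (hq0 : 0 < q)
    (hr0 : 0 ≤ r) (hr1 : r < 1) (hb : 0 < b) (hn : 1 ≤ n) (hm : 1 ≤ m) (hJn : J ≤ n)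
    (hJr : q * (n - J) ≤ r * p * (J + 1)) (hJb : b * n ≤ n - J + 1)
    (hmJ : q ≤ m * q ^ J) (hmJ' : m * q ^ J ≤ 1)
    (hS : HasSum (fun t : ℕ => (1 / (b * q)) ^ t * Real.exp (-(q ^ 2 * (1 / q) ^ t))) S) :
    expectedMin n m p ≤
      (Real.exp 1 * S + 1 / (1 - r)) * ((n.choose J : ℝ) * (p : ℝ) ^ (n - J)) := by
  have hp1 : (p : ℝ) ≤ 1 := p.2.2
  have hq1 : q ≤ 1 := by linarith
  have hpow1 : ∀ j, q ^ j ≤ 1 := fun j => pow_le_one₀ hq0.le hq1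
  have hppow1 : ∀ j, (p : ℝ) ^ j ≤ 1 := fun j => pow_le_one₀ hp0.le hp1
  set W : ℝ := (n.choose J : ℝ) * q ^ J * (p : ℝ) ^ (n - J) with hW
  set f : ℕ → ℝ := fun j => (n.choose j : ℝ) *
    ((1 - q ^ j * (1 - (p : ℝ) ^ (n - j))) ^ m - (1 - q ^ j) ^ m) with hf
  have hterm : ∀ j, f j ≤ m * ((n.choose j : ℝ) * q ^ j * (p : ℝ) ^ (n - j)) *
      (1 - q ^ j * (1 - (p : ℝ) ^ (n - j))) ^ (m - 1) := fun j => by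
    have hab : 1 - q ^ j ≤ 1 - q ^ j * (1 - (p : ℝ) ^ (n - j)) := by
      have : 0 ≤ q ^ j * (p : ℝ) ^ (n - j) := by positivity
      linarith
    have := pow_sub_pow_le_mul_sub_mul_pow (sub_nonneg.2 (hpow1 j)) hab m
    calc f j ≤ (n.choose j : ℝ) * _ := mul_le_mul_of_nonneg_left this (by positivity)
      _ = _ := by ring
  -- Sets missing at least `J` vertices: the expected number of edges of this kind is summed.
  have hhigh : ∑ i ∈ Finset.range (n + 1 - J), f (J + i) ≤ 1 / (1 - r) * (m * W) := by
    calc ∑ i ∈ Finset.range (n + 1 - J), f (J + i)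
        ≤ ∑ i ∈ Finset.range (n + 1 - J), r ^ i * (m * W) := by
          refine Finset.sum_le_sum fun i _ => (hterm _).trans ?_
          have h1 : (1 - q ^ (J + i) * (1 - (p : ℝ) ^ (n - (J + i)))) ^ (m - 1) ≤ 1 := by
            have h2 := mul_nonneg (pow_nonneg hq0.le (J + i))
              (sub_nonneg.2 (hppow1 (n - (J + i))))
            refine pow_le_one₀ ?_ (by linarith)
            have := mul_le_one₀ (hpow1 (J + i)) (sub_nonneg.2 (hppow1 (n - (J + i))))
              (sub_le_self 1 (pow_nonneg hp0.le (n - (J + i))))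
            linarith
          have h2 := binomial_weight_add_le hp0 hq0 hr0 hJr i
          calc _ ≤ m * ((n.choose (J + i) : ℝ) * q ^ (J + i) * (p : ℝ) ^ (n - (J + i))) * 1 := by
                gcongr
            _ ≤ m * (r ^ i * W) * 1 := by gcongr
            _ = _ := by ring
      _ = (∑ i ∈ Finset.range (n + 1 - J), r ^ i) * (m * W) := by rw [Finset.sum_mul]
      _ ≤ _ := by
          gcongr
          rw [one_div, ← tsum_geometric_of_lt_one hr0 hr1]
          exact (summable_geometric_of_lt_one hr0 hr1).sum_le_tsum _ fun _ _ => by positivity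
  -- Sets missing `J - t` vertices with `t = i + 1 ≥ 1`: there are at most `(1 / b) ^ t` times as
  -- many as with `t = 0`, but each contains about `(1 / q) ^ t` edges, most of them proper subsets.
  have hlow : ∑ i ∈ Finset.range J, f (J - 1 - i) ≤ Real.exp 1 * S * (m * W) := by
    calc ∑ i ∈ Finset.range J, f (J - 1 - i)
        ≤ ∑ i ∈ Finset.range J, (1 / (b * q)) ^ (i + 1) *
            Real.exp (-(q ^ 2 * (1 / q) ^ (i + 1))) * (Real.exp 1 * (m * W)) := by
          refine Finset.sum_le_sum fun i hi => ?_
          have hi := Finset.mem_range.1 hi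
          obtain ⟨j, hj⟩ : ∃ j, J - 1 - i = j := ⟨_, rfl⟩
          have hJj : J = j + (i + 1) := by omega
          rw [hj]
          have h6 : q ^ j = q ^ J * (1 / q) ^ (i + 1) := by
            rw [hJj, pow_add q j, one_div, inv_pow]
            field_simp
          have hx : (p : ℝ) ^ (n - j) ≤ 1 - q := by
            calc (p : ℝ) ^ (n - j) ≤ (p : ℝ) ^ 1 :=
                  pow_le_pow_of_le_one hp0.le hp1 (by omega)
              _ = _ := by rw [pow_one]; linarith
          have h1 := one_sub_pow_le_exp hq0.le hq1 (j := j) (m := m - 1)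
            (pow_nonneg hp0.le (n - j)) hx
          have h2 : Real.exp (-((m - 1 : ℕ) * q ^ (j + 1))) ≤
              Real.exp 1 * Real.exp (-(q ^ 2 * (1 / q) ^ (i + 1))) := by
            rw [← Real.exp_add, Real.exp_le_exp, Nat.cast_sub hm]
            have h3 : q ^ 2 * (1 / q) ^ (i + 1) ≤ m * q ^ (j + 1) := by
              have : m * q ^ (j + 1) = m * q ^ J * (q * (1 / q) ^ (i + 1)) := by
                rw [pow_succ, h6]; ring
              rw [this]
              calc q ^ 2 * (1 / q) ^ (i + 1) = q * (q * (1 / q) ^ (i + 1)) := by ring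
                _ ≤ _ := by gcongr
            have := hpow1 (j + 1)
            push_cast
            linarith
          have h4 : (n.choose j : ℝ) ≤ (1 / b) ^ (i + 1) * n.choose J := by
            have := choose_sub_le hb hn hJn hJb (by omega : i + 1 ≤ J)
            rwa [show J - (i + 1) = j by omega] at this
          have h5 : (p : ℝ) ^ (n - j) ≤ (p : ℝ) ^ (n - J) :=
            pow_le_pow_of_le_one hp0.le hp1 (by omega)
          calc f j ≤ m * ((n.choose j : ℝ) * q ^ j * (p : ℝ) ^ (n - j)) *
                (1 - q ^ j * (1 - (p : ℝ) ^ (n - j))) ^ (m - 1) := hterm j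
            _ ≤ m * ((n.choose j : ℝ) * q ^ j * (p : ℝ) ^ (n - j)) *
                (Real.exp 1 * Real.exp (-(q ^ 2 * (1 / q) ^ (i + 1)))) := by
                gcongr
                exact h1.trans h2
            _ ≤ m * (((1 / b) ^ (i + 1) * n.choose J) * (q ^ J * (1 / q) ^ (i + 1)) *
                (p : ℝ) ^ (n - J)) *
                (Real.exp 1 * Real.exp (-(q ^ 2 * (1 / q) ^ (i + 1)))) := by
                rw [h6]
                gcongr
            _ = _ := by
                rw [hW, ← one_div_mul_one_div b q, mul_pow (1 / b)]
                ring
      _ = (∑ i ∈ Finset.range J, (1 / (b * q)) ^ (i + 1) *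
            Real.exp (-(q ^ 2 * (1 / q) ^ (i + 1)))) * (Real.exp 1 * (m * W)) := by
          rw [Finset.sum_mul]
      _ ≤ S * (Real.exp 1 * (m * W)) := by
          gcongr
          have h1 := sum_le_hasSum (Finset.range (J + 1)) (fun t _ => by positivity) hS
          rw [Finset.sum_range_succ'] at h1
          refine le_trans ?_ h1
          exact le_add_of_nonneg_right (by positivity)
      _ = _ := by ring
  have hsplit : expectedMin n m p =
      ∑ i ∈ Finset.range J, f (J - 1 - i) + ∑ i ∈ Finset.range (n + 1 - J), f (J + i) := by
    rw [expectedMin_eq_sum, ← hq, Finset.sum_range_reflect f J,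
      ← Finset.sum_range_add_sum_Ico f (by omega : J ≤ n + 1), Finset.sum_Ico_eq_sum_range]
  have hS0 : 0 ≤ S := hS.nonneg fun t => by positivity
  have hr' : 0 < 1 - r := by linarith
  calc expectedMin n m p ≤ Real.exp 1 * S * (m * W) + 1 / (1 - r) * (m * W) := by
        rw [hsplit]; exact add_le_add hlow hhigh
    _ = (Real.exp 1 * S + 1 / (1 - r)) * ((m * q ^ J) *
          ((n.choose J : ℝ) * (p : ℝ) ^ (n - J))) := by rw [hW]; ring
    _ ≤ (Real.exp 1 * S + 1 / (1 - r)) * (1 * ((n.choose J : ℝ) * (p : ℝ) ^ (n - J))) := by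
        gcongr
    _ = _ := by rw [one_mul]

/-! ### The information-theoretic regime -/

theorem rpow_logDensity_mul {n m : ℕ} {p : unitInterval} {q : ℝ} (hq : q = 1 - (p : ℝ))
    (hq0 : 0 < q) (hq1 : q < 1) (hn : 1 ≤ n) (hm : 1 ≤ m) :
    q ^ (logDensity n m p * n) = 1 / m := by
  have hn0 : (n : ℝ) ≠ 0 := by positivity
  have hm0 : (0 : ℝ) < m := by exact_mod_cast hm
  rw [logDensity, div_mul_cancel₀ _ hn0, ← hq, Real.rpow_neg hq0.le,
    Real.rpow_logb hq0 hq1.ne hm0, one_div]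

theorem two_rpow_entropyBits_mul {p α : ℝ} (hp0 : 0 < p) (hα0 : 0 < α) (hα1 : α < 1) (n : ℕ) :
    (2 : ℝ) ^ ((entropyBits α + (1 - α) * Real.logb 2 p) * n)
      = (p ^ (1 - α) / ((1 - α) ^ (1 - α) * α ^ α)) ^ n := by
  have hβ0 : 0 < 1 - α := by linarith
  have h2 : ∀ x y : ℝ, 0 < x → (2 : ℝ) ^ (y * Real.logb 2 x) = x ^ y := fun x y hx => by
    rw [mul_comm, Real.rpow_mul (by norm_num), Real.rpow_logb (by norm_num) (by norm_num) hx]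
  rw [Real.rpow_mul_natCast (by norm_num), entropyBits,
    show -α * Real.logb 2 α - (1 - α) * Real.logb 2 (1 - α) + (1 - α) * Real.logb 2 p
      = (1 - α) * Real.logb 2 p - ((1 - α) * Real.logb 2 (1 - α) + α * Real.logb 2 α) by ring,
    Real.rpow_sub (by norm_num), Real.rpow_add (by norm_num), h2 _ _ hp0, h2 _ _ hβ0, h2 _ _ hα0]

theorem one_div_rpow_le_iff {q x y m : ℝ} (hq0 : 0 < q) (hq1 : q < 1) (hm : q ^ y = 1 / m) :
    (1 / q ^ x ≤ m ↔ x ≤ y) ∧ (m ≤ 1 / q ^ x ↔ y ≤ x) := by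
  have hx := Real.rpow_pos_of_pos hq0 x
  have hm' : m = 1 / q ^ y := by rw [hm]; simp
  have hy := Real.rpow_pos_of_pos hq0 y
  rw [hm', one_div_le_one_div hx hy, one_div_le_one_div hy hx,
    Real.rpow_le_rpow_left_iff_of_base_lt_one hq0 hq1,
    Real.rpow_le_rpow_left_iff_of_base_lt_one hq0 hq1]
  exact ⟨Iff.rfl, Iff.rfl⟩

theorem entropy_bounds_expectedMin {p : unitInterval} (hp0 : 0 < (p : ℝ)) (hp1 : (p : ℝ) < 1)
    {ε ε' : ℝ} (hε : 0 < ε) (hε' : 0 < ε') :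
    ∃ c C : ℝ, 0 < c ∧ 0 < C ∧ ∀ n m : ℕ, 1 ≤ n → 1 ≤ m →
      1 - (p : ℝ) + ε ≤ logDensity n m p → logDensity n m p ≤ 1 - ε' →
        c * (((p : ℝ) ^ (1 - logDensity n m p) /
            ((1 - logDensity n m p) ^ (1 - logDensity n m p)
              * logDensity n m p ^ logDensity n m p)) ^ n / √(n : ℝ)) ≤ expectedMin n m p ∧
        expectedMin n m p ≤ C * (((p : ℝ) ^ (1 - logDensity n m p) /
            ((1 - logDensity n m p) ^ (1 - logDensity n m p)
              * logDensity n m p ^ logDensity n m p)) ^ n / √(n : ℝ)) := by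
  obtain ⟨q, hq⟩ : ∃ q, q = 1 - (p : ℝ) := ⟨_, rfl⟩
  have hq0 : 0 < q := by linarith
  have hq1 : q < 1 := by linarith
  obtain ⟨c, C, hc, hC, hcC⟩ := choose_mul_pow_bounds hp0 hp1.le hq0 hε'
  obtain ⟨S, hS⟩ := summable_pow_mul_exp_neg_mul_pow (R := 1 / (ε' * q)) (c := q ^ 2) (a := 1 / q)
    (by positivity) (by positivity) (by rw [lt_div_iff₀ hq0]; linarith)
  have hS0 : 0 ≤ S := hS.nonneg fun t => by positivity
  have hr1 : q / (q + ε) < 1 := by rw [div_lt_one (by linarith)]; linarith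
  have hr : 0 < 1 - q / (q + ε) := by linarith
  refine ⟨Real.exp (-1) * (q * c), (Real.exp 1 * S + 1 / (1 - q / (q + ε))) * C,
    by positivity, by positivity, fun n m hn hm h1 h2 => ?_⟩
  obtain ⟨α, hα⟩ : ∃ α, logDensity n m p = α := ⟨_, rfl⟩
  have hqα := rpow_logDensity_mul hq hq0 hq1 hn hm
  rw [hα] at h1 h2 hqα ⊢
  rw [← hq] at h1
  have hn0 : (0 : ℝ) < n := by exact_mod_cast hn
  have hm0 : (0 : ℝ) < m := by exact_mod_cast hm
  have hα0 : 0 < α := by linarith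
  have hJ1 : α * n ≤ ⌈α * n⌉₊ := Nat.le_ceil _
  have hJ2 : (⌈α * n⌉₊ : ℝ) < α * n + 1 := Nat.ceil_lt_add_one (by positivity)
  have hJn : ⌈α * n⌉₊ ≤ n := Nat.ceil_le.2 (by nlinarith)
  generalize ⌈α * (n : ℝ)⌉₊ = J at hJ1 hJ2 hJn
  obtain ⟨k, rfl⟩ := Nat.exists_eq_add_of_le hJn
  obtain ⟨hlow, hupp⟩ := hcC α J k hn (by linarith) (by linarith) hJ1 hJ2.le
  obtain ⟨hm1, hm2⟩ := rpow_bounds_of_le_of_le_add_one hq0 hq1.le hJ1 hJ2.le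
  rw [hqα, Real.rpow_natCast] at hm1 hm2
  have hmJ : q ≤ m * q ^ J := by
    calc q = m * (q * (1 / m)) := by field_simp
      _ ≤ _ := by gcongr
  have hmJ' : m * q ^ J ≤ 1 := by
    calc m * q ^ J ≤ m * (1 / m) := by gcongr
      _ = 1 := by field_simp
  constructor
  · have h := mul_sum_le_expectedMin (n := J + k) (m := m) hq (s := {J})
      (by simp) (by simpa using hmJ')
    rw [Finset.sum_singleton, Nat.add_sub_cancel_left] at h
    refine le_trans ?_ h
    calc _ = Real.exp (-1) * (q * (c * (((p : ℝ) ^ (1 - α) / ((1 - α) ^ (1 - α) * α ^ α)) ^ (J + k)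
            / √((J + k : ℕ) : ℝ)))) := by ring
      _ ≤ Real.exp (-1) * (q * (((J + k).choose J : ℝ) * (p : ℝ) ^ k)) := by gcongr
      _ ≤ Real.exp (-1) * ((m * q ^ J) * (((J + k).choose J : ℝ) * (p : ℝ) ^ k)) := by gcongr
      _ = _ := by ring
  · have h := expectedMin_le_of_geometric hq hp0 hq0 (by positivity) hr1 hε' hn hm hJn
      (?_ : q * (((J + k : ℕ) : ℝ) - J) ≤ q / (q + ε) * p * (J + 1)) ?_ hmJ hmJ' hS
    · rw [Nat.add_sub_cancel_left] at h
      refine h.trans ?_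
      rw [mul_assoc]
      gcongr
    · have h3 : (q + ε) * (((J + k : ℕ) : ℝ) - J) ≤ p * (J + 1) := by
        have h4 : (q + ε) * (J + k : ℕ) ≤ α * (J + k : ℕ) := by gcongr
        have h5 : ((J + k : ℕ) : ℝ) - J ≤ p * (J + k : ℕ) := by
          have : (p : ℝ) = 1 - q := by linarith
          rw [this]
          nlinarith
        calc (q + ε) * (((J + k : ℕ) : ℝ) - J) ≤ (q + ε) * (p * (J + k : ℕ)) := by gcongr
          _ = p * ((q + ε) * (J + k : ℕ)) := by ring
          _ ≤ p * (J + 1) := by gcongr; linarith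
      calc q * (((J + k : ℕ) : ℝ) - J) = q / (q + ε) * ((q + ε) * (((J + k : ℕ) : ℝ) - J)) := by
            field_simp
        _ ≤ q / (q + ε) * (p * (J + 1)) := by gcongr
        _ = _ := by ring
    · nlinarith

/-! ### Beyond the information-theoretic regime -/

/-- If the empty set is expected to occur at least `L` times among the edges, a set of size `i` is
minimal with probability at most `x ^ i`, where `x = exp (-c L)`; the binomial theorem sums these
bounds to `(1 + x) ^ n`. -/
theorem expectedMin_le_exp {n m : ℕ} {p : unitInterval} {q c L : ℝ}
    (hq : q = 1 - (p : ℝ)) (hq0 : 0 < q) (hc1 : c ≤ 1) (hcq : c ≤ 1 / q - 1)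
    (hL0 : 0 ≤ L) (hL : L ≤ m * q ^ n) :
    expectedMin n m p ≤ Real.exp (n * Real.exp (-(c * L))) := by
  have hp0 : 0 ≤ (p : ℝ) := p.2.1
  have hp1 : (p : ℝ) ≤ 1 := p.2.2
  have hq1 : q ≤ 1 := by linarith
  set x := Real.exp (-(c * L))
  have hterm : ∀ j ∈ Finset.range (n + 1), (n.choose j : ℝ) *
      ((1 - q ^ j * (1 - (p : ℝ) ^ (n - j))) ^ m - (1 - q ^ j) ^ m) ≤
      1 ^ j * x ^ (n - j) * n.choose j := by
    intro j hj
    have hj : j ≤ n := Nat.lt_succ_iff.1 (Finset.mem_range.1 hj)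
    have h0 : 0 ≤ (1 - q ^ j) ^ m := pow_nonneg (sub_nonneg.2 (pow_le_one₀ hq0.le hq1)) m
    rw [one_pow, one_mul, mul_comm]
    gcongr
    rcases hj.eq_or_lt with rfl | hj
    · simp [h0]
    obtain ⟨i, rfl⟩ : ∃ i, n = j + 1 + i := ⟨n - (j + 1), by omega⟩
    have hx : (p : ℝ) ^ (j + 1 + i - j) ≤ 1 - q := by
      calc (p : ℝ) ^ (j + 1 + i - j) ≤ (p : ℝ) ^ 1 := pow_le_pow_of_le_one hp0 hp1 (by omega)
        _ = _ := by rw [pow_one]; linarith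
    have h1 := one_sub_pow_le_exp hq0.le hq1 (j := j) (m := m) (pow_nonneg hp0 _) hx
    refine (sub_le_self _ h0).trans (h1.trans ?_)
    rw [← Real.exp_nat_mul, Real.exp_le_exp, show j + 1 + i - j = i + 1 by omega]
    have h2 : c * (i + 1 : ℕ) ≤ (1 / q) ^ i := by
      have := one_add_mul_le_pow (by linarith [one_div_pos.2 hq0] : -2 ≤ 1 / q - 1) i
      rw [add_sub_cancel] at this
      push_cast
      nlinarith [(Nat.cast_nonneg i : (0 : ℝ) ≤ i)]
    have h3 : m * q ^ (j + 1) = m * q ^ (j + 1 + i) * (1 / q) ^ i := by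
      rw [pow_add q (j + 1), one_div, inv_pow]
      field_simp
    rw [h3]
    have h4 : L * (c * (i + 1 : ℕ)) ≤ m * q ^ (j + 1 + i) * (1 / q) ^ i :=
      (mul_le_mul_of_nonneg_left h2 hL0).trans (by gcongr)
    linarith
  rw [expectedMin_eq_sum, ← hq]
  calc _ ≤ ∑ j ∈ Finset.range (n + 1), 1 ^ j * x ^ (n - j) * (n.choose j : ℝ) :=
        Finset.sum_le_sum hterm
    _ = (1 + x) ^ n := (add_pow 1 x n).symm
    _ ≤ (Real.exp x) ^ n := by
        gcongr
        linarith [Real.add_one_le_exp x]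
    _ = _ := (Real.exp_nat_mul x n).symm

theorem tendsto_expectedMin_one {p : unitInterval} (hp0 : 0 < (p : ℝ)) (hp1 : (p : ℝ) < 1)
    {m : ℕ → ℕ} {f : ℕ → ℝ} (hf : Tendsto (fun n : ℕ => f n / Real.log n) atTop atTop)
    (hm : ∀ n : ℕ, 1 ≤ n → (m n : ℝ) = 1 / (1 - (p : ℝ)) ^ ((n : ℝ) + f n)) :
    (∀ n : ℕ, 1 ≤ n → 1 ≤ expectedMin n (m n) p) ∧
      Tendsto (fun n : ℕ => expectedMin n (m n) p) atTop (𝓝 1) := by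
  obtain ⟨q, hq⟩ : ∃ q, q = 1 - (p : ℝ) := ⟨_, rfl⟩
  have hq0 : 0 < q := by linarith
  have hq1 : q < 1 := by linarith
  rw [← hq] at hm
  have hone : ∀ n : ℕ, 1 ≤ n → 1 ≤ expectedMin n (m n) p := fun n hn => by
    refine one_le_expectedMin n ?_ p
    have : (0 : ℝ) < m n := by rw [hm n hn]; positivity
    exact_mod_cast this
  refine ⟨hone, ?_⟩
  obtain ⟨c, hc0, hc1, hcq⟩ : ∃ c : ℝ, 0 < c ∧ c ≤ 1 ∧ c ≤ 1 / q - 1 :=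
    ⟨min 1 (1 / q - 1), lt_min one_pos (by rw [sub_pos, lt_div_iff₀ hq0]; linarith),
      min_le_left _ _, min_le_right _ _⟩
  -- Eventually `f n ≥ log n / log (1 / q)`, so that the empty set occurs `q ^ (-f n) ≥ n` times on
  -- average, and the bound `exp (n exp (-c n))` applies.
  have hlim : Tendsto (fun n : ℕ => Real.exp (n * Real.exp (-(c * n)))) atTop (𝓝 1) := by
    have h := (Real.tendsto_pow_mul_exp_neg_atTop_nhds_zero 1).comp
      (tendsto_natCast_atTop_atTop.const_mul_atTop hc0)
    have h2 := (Real.continuous_exp.tendsto _).comp (h.const_mul (1 / c))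
    simp only [mul_zero, Real.exp_zero] at h2
    refine h2.congr fun n => ?_
    simp only [Function.comp_apply, pow_one]
    congr 1
    field_simp
  refine tendsto_of_tendsto_of_tendsto_of_le_of_le' tendsto_const_nhds hlim
    (eventually_atTop.2 ⟨1, hone⟩) ?_
  have hlogq : 0 < -Real.log q := neg_pos.2 (Real.log_neg hq0 hq1)
  filter_upwards [hf.eventually_ge_atTop (1 / (-Real.log q)), eventually_ge_atTop 2] with n hn hn2
  have hn1 : 1 ≤ n := by omega
  have hlog : 0 < Real.log n := Real.log_pos (by exact_mod_cast hn2)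
  have hn0 : (0 : ℝ) < n := by exact_mod_cast hn1
  refine expectedMin_le_exp hq hq0 hc1 hcq hn0.le ?_
  have hmn : (m n : ℝ) * q ^ n = Real.exp (f n * -Real.log q) := by
    rw [hm n hn1, Real.rpow_add hq0, Real.rpow_natCast, Real.rpow_def_of_pos hq0, mul_neg,
      Real.exp_neg, mul_comm (f n)]
    field_simp
  rw [hmn, ← Real.log_le_iff_le_exp hn0]
  rw [le_div_iff₀ hlog, div_mul_eq_mul_div, one_mul, div_le_iff₀ hlogq] at hn
  exact hn

/-! ### The three regimes -/

theorem theorem1 (p : unitInterval) :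
    ((p = 0 ∨ p = 1) → ∀ n m : ℕ, 1 ≤ n → 1 ≤ m →
      ∀ᵐ X ∂(trialLaw n m p), (ofTrials X).minimization.ncard = 1) ∧
    (0 < (p : ℝ) → (p : ℝ) < 1 →
      -- the linear regime
      (∃ c C : ℝ, 0 < c ∧ 0 < C ∧ ∀ n m : ℕ, 1 ≤ n → 1 ≤ m →
        (m : ℝ) ≤ 1 / (1 - (p : ℝ)) ^ ((1 - (p : ℝ)) * n) →
          c * m ≤ expectedMin n m p ∧ expectedMin n m p ≤ C * m) ∧
      -- the information-theoretic regime
      (∀ ε ε' : ℝ, 0 < ε → 0 < ε' → ∃ c C : ℝ, 0 < c ∧ 0 < C ∧ ∀ n m : ℕ, 1 ≤ n → 1 ≤ m →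
        ((1 / (1 - (p : ℝ)) ^ ((1 - (p : ℝ) + ε) * n) ≤ (m : ℝ) ∧
            (m : ℝ) ≤ 1 / (1 - (p : ℝ)) ^ ((1 - ε') * n)) ↔
          (1 - (p : ℝ) + ε ≤ logDensity n m p ∧ logDensity n m p ≤ 1 - ε')) ∧
        (1 - (p : ℝ) + ε ≤ logDensity n m p → logDensity n m p ≤ 1 - ε' →
          (c * ((2 : ℝ) ^ ((entropyBits (logDensity n m p)
                + (1 - logDensity n m p) * Real.logb 2 p) * n) / √(n : ℝ)) ≤ expectedMin n m p ∧
            expectedMin n m p ≤ C * ((2 : ℝ) ^ ((entropyBits (logDensity n m p)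
                + (1 - logDensity n m p) * Real.logb 2 p) * n) / √(n : ℝ))) ∧
          (c * (((p : ℝ) ^ (1 - logDensity n m p) /
                ((1 - logDensity n m p) ^ (1 - logDensity n m p)
                  * logDensity n m p ^ logDensity n m p)) ^ n / √(n : ℝ)) ≤ expectedMin n m p ∧
            expectedMin n m p ≤ C * (((p : ℝ) ^ (1 - logDensity n m p) /
                ((1 - logDensity n m p) ^ (1 - logDensity n m p)
                  * logDensity n m p ^ logDensity n m p)) ^ n / √(n : ℝ))))) ∧
      -- beyond the information-theoretic regime; `f` is of order `ω(log n)`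
      (∀ (m : ℕ → ℕ) (f : ℕ → ℝ),
        Tendsto (fun n : ℕ => f n / Real.log n) atTop atTop →
        (∀ n : ℕ, 1 ≤ n → (m n : ℝ) = 1 / (1 - (p : ℝ)) ^ ((n : ℝ) + f n)) →
          (∀ n : ℕ, 1 ≤ n → 1 ≤ expectedMin n (m n) p) ∧
          Tendsto (fun n : ℕ => expectedMin n (m n) p) atTop (𝓝 1))) := by
  refine ⟨?_, fun hp0 hp1 => ⟨linear_bounds_expectedMin hp0 hp1, fun ε ε' hε hε' => ?_,
    fun m f hf hm => tendsto_expectedMin_one hp0 hp1 hf hm⟩⟩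
  · rintro (rfl | rfl) n m - hm
    · exact ae_ncard_minimization_eq_one_of_dirac hm (setBernoulli_zero _)
    · exact ae_ncard_minimization_eq_one_of_dirac hm (setBernoulli_one _)
  · have hq0 : 0 < 1 - (p : ℝ) := by linarith
    have hq1 : 1 - (p : ℝ) < 1 := by linarith
    obtain ⟨c, C, hc, hC, h⟩ := entropy_bounds_expectedMin hp0 hp1 hε hε'
    refine ⟨c, C, hc, hC, fun n m hn hm => ⟨?_, fun h1 h2 => ?_⟩⟩
    · have hn0 : (0 : ℝ) < n := by exact_mod_cast hn
      have hα := rpow_logDensity_mul rfl hq0 hq1 hn hm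
      rw [(one_div_rpow_le_iff hq0 hq1 hα).1, (one_div_rpow_le_iff hq0 hq1 hα).2,
        mul_le_mul_iff_left₀ hn0, mul_le_mul_iff_left₀ hn0]
    · rw [two_rpow_entropyBits_mul hp0 (by linarith) (by linarith)]
      exact ⟨h n m hn hm h1 h2, h n m hn hm h1 h2⟩
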